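/- Let $(X,d)$ be a metric space and $\mu$ a Borel measure on $X$ with $0<\mu(B(x,r))<\infty$ for every open ball $B(x,r)$, $r\in(0,\infty)$. **Exponents.** $\mathcal P(X)$ is the set of measurable $p:X\to(0,\infty]$ with $p^-:=\operatorname{ess\,inf}p>0$; $\mathcal P_b(X)$ is the set of those with also $p^+:=\operatorname{ess\,sup}p<\infty$. **Lebesgue spaces.** For $t\ge0$ put $\varphi_p(t)=t^p$ if $p<\infty$, and $\varphi_\infty(t)=0$ for $t\le1$, $\varphi_\infty(t)=\infty$ for $t>1$. Let $\rho_{p(\cdot)}(u)=\int_X\varphi_{p(x)}(|u(x)|)\,d\mu(x)$. Then $L^{p(\cdot)}(X,\mu)$ is the space of measurable $u$ with $\rho_{p(\cdot)}(\lambda u)<\infty$ for some $\lambda\in(0,\infty)$, with quasi-norm $\|u\|_{L^{p(\cdot)}}=\inf\{\lambda\in(0,\infty):\rho_{p(\cdot)}(u/\lambda)\le1\}$. **Mixed spaces.** For sequences $g=(g_k)_{k\in\mathbb Z}$ of non-negative measurable functions let $$\|g\|_{L^{p(\cdot)}(\ell^{q(\cdot)})}=\Big\|\,x\mapsto\|(g_k(x))_k\|_{\ell^{q(x)}}\Big\|_{L^{p(\cdot)}},\qquad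 \|g\|_{\ell^{q(\cdot)}(L^{p(\cdot)})}=\inf\Big\{m\in(0,\infty):\ \sum_{k\in\mathbb Z}\inf\big\{\lambda\in(0,\infty):\rho_{p(\cdot)}\big(g_k/(m\lambda^{1/q(\cdot)})\big)\le1\big\}\le1\Big\},$$ with $\lambda^{1/\infty}=1$ and $\inf\emptyset=\infty$. **Smoothness spaces.** Let $u$ be measurable and finite a.e. Such a sequence $g$ of $[0,\infty]$-valued functions is a *vector $s(\cdot)$-gradient* of $u$, $g\in\mathbb D^{s(\cdot)}(u)$, if there is a $\mu$-null set $N$ such that $$|u(x)-u(y)|\le d(x,y)^{s(x)}g_k(x)+d(x,y)^{s(y)}g_k(y)$$ whenever $k\in\mathbb Z$, $x,y\in X\setminus N$ and $2^{-k-1}\le d(x,y)<2^{-k}$. The Hajłasz–Triebel–Lizorkin space $M^{s(\cdot)}_{p(\cdot),q(\cdot)}$ and the Hajłasz–Besov space $N^{s(\cdot)}_{p(\cdot),q(\cdot)}$ consist of those $u\in L^{p(\cdot)}(X,\mu)$ for which, respectively, the quasi-norms $$\|u\|_{L^{p(\cdot)}}+\inf_{g\in\mathbb D^{s(\cdot)}(u)}\|g\|_{L^{p(\cdot)}(\ell^{q(\cdot)})},\qquad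 \|u\|_{L^{p(\cdot)}}+\inf_{g\in\mathbb D^{s(\cdot)}(u)}\|g\|_{\ell^{q(\cdot)}(L^{p(\cdot)})}$$ are finite. **Isometries.** $\mathrm{Iso}_\mu(X,d)$ is the group of isometries $\varphi$ of $X$ onto itself with $\varphi_\#\mu=\mu$, with the topology of pointwise convergence (equivalently, the compact-open topology). For a subgroup $H$, the spaces $M^{s(\cdot),H}_{p(\cdot),q(\cdot)}$ and $N^{s(\cdot),H}_{p(\cdot),q(\cdot)}$ are the subspaces of those $u$ with $u\circ\varphi=u$ for all $\varphi\in H$. Let $H(x)=\{h(x):h\in H\}$ and $$M_H(x,r)=\sup\{\#A:\ A\subseteq H(x),\ B(\xi,r)\cap B(\eta,r)=\emptyset\text{ for all distinct }\xi,\eta\in A\}.$$ **Theorem.** Suppose that $X$ is unbounded, $\sup_{x\in X}\mu(B(x,1))<\infty$, and $\inf_{x\in X}\mu(B(x,r))>0$ for every $r\in(0,1)$. Let $H$ be a compact subgroup of $\mathrm{Iso}_\mu(X,d)$. Let $s,p,\beta\in\mathcal P_b(X)$ and $q\in\mathcal P(X)$ be such that either $s^+<1$ and $q^-<\infty$, or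 $s^+\le1$ and $q^-=\infty$. Suppose that at least one of the spaces $M^{s(\cdot),H}_{p(\cdot),q(\cdot)}$, $N^{s(\cdot),H}_{p(\cdot),q(\cdot)}$ embeds compactly into $L^{\beta(\cdot)}(X,\mu)$, i.e. it is contained in $L^{\beta(\cdot)}(X,\mu)$ and each of its bounded sequences has a subsequence converging in $L^{\beta(\cdot)}(X,\mu)$. Then for every $x_0\in X$ and every $r\in(0,1/3)$, $$\lim_{R\to\infty}\ \sup_{x\in X\setminus B(x_0,R)}M_H(x,r)=\infty.$$ -/

import Mathlib

open MeasureTheory Set Filter Topology Metric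
open scoped ENNReal

/-- The group `Iso_μ(X,d)` of measure-preserving isometries: surjective isometries `φ` of `X`
whose pushforward of `μ` is `μ`. -/
def isoMu {X : Type*} [MetricSpace X] [MeasurableSpace X] [BorelSpace X] (μ : Measure X) :
    Subgroup (X ≃ᵢ X) where
  carrier := {φ | Measure.map (φ : X → X) μ = μ}
  one_mem' := Measure.map_id
  mul_mem' := by
    intro φ ψ hφ hψ
    have h : Measure.map (fun x => φ (ψ x)) μ = Measure.map φ (Measure.map ψ μ) :=
      (Measure.map_map φ.continuous.measurable ψ.continuous.measurable).symm
    change Measure.map (fun x => φ (ψ x)) μ = μ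
    rw [h, show Measure.map ψ μ = μ from hψ]
    exact hφ
  inv_mem' := by
    intro φ hφ
    change Measure.map (fun x => φ.symm x) μ = μ
    conv_lhs => rw [← show Measure.map φ μ = μ from hφ]
    rw [Measure.map_map φ.symm.continuous.measurable φ.continuous.measurable]
    have h : (fun x => φ.symm x) ∘ φ = id := by
      funext x
      simp
    rw [h, Measure.map_id]

/-- Compactness of a subgroup of the isometry group, for the topology of pointwise convergence
(on isometries of a metric space this is the same as the compact-open topology). -/
def IsCompactIsoSubgroup {X : Type*} [MetricSpace X] (H : Subgroup (X ≃ᵢ X)) : Prop :=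
  @IsCompact (X ≃ᵢ X)
    (TopologicalSpace.induced (fun φ : X ≃ᵢ X => (φ : X → X)) Pi.topologicalSpace)
    (H : Set (X ≃ᵢ X))

/-- The orbit `H(x)`. -/
def isoOrbit {X : Type*} [MetricSpace X] (H : Subgroup (X ≃ᵢ X)) (x : X) : Set X :=
  {y | ∃ h ∈ H, h x = y}

/-- `M_H(x,r)`: the supremum of the cardinalities of the sets `A ⊆ H(x)` such that the balls of
radius `r` centred at distinct points of `A` are disjoint. -/
noncomputable def orbitPacking {X : Type*} [MetricSpace X] (H : Subgroup (X ≃ᵢ X))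
    (x : X) (r : ℝ) : ℕ∞ :=
  ⨆ A ∈ {A : Set X | A ⊆ isoOrbit H x ∧
    ∀ ξ ∈ A, ∀ η ∈ A, ξ ≠ η → ball ξ r ∩ ball η r = ∅}, A.encard

section Exponents

variable {X : Type*} [MeasurableSpace X]

/-- The class `𝒫(X)` of variable exponents: measurable `p : X → (0,∞]` with `p⁻ > 0`. -/
def IsExponent (μ : Measure X) (p : X → ℝ≥0∞) : Prop :=
  Measurable p ∧ (∀ x, 0 < p x) ∧ 0 < essInf p μ

/-- The class `𝒫_b(X)` of essentially bounded variable exponents. -/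
def IsBddExponent (μ : Measure X) (p : X → ℝ≥0∞) : Prop :=
  IsExponent μ p ∧ essSup p μ < ∞

open Classical in
/-- The function `φ_p(t)`. -/
noncomputable def phiExp (p t : ℝ≥0∞) : ℝ≥0∞ :=
  if p = ∞ then (if t ≤ 1 then 0 else ∞) else t ^ p.toReal

/-- The semi-modular `ρ_{p(·)}` of a non-negative function. -/
noncomputable def rhoMod (μ : Measure X) (p : X → ℝ≥0∞) (f : X → ℝ≥0∞) : ℝ≥0∞ :=
  ∫⁻ x, phiExp (p x) (f x) ∂μ

/-- The Luxemburg quasi-norm of a non-negative function, with value `∞` if no `l` is admissible. -/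
noncomputable def luxNorm (μ : Measure X) (p : X → ℝ≥0∞) (f : X → ℝ≥0∞) : ℝ≥0∞ :=
  sInf {l : ℝ≥0∞ | 0 < l ∧ l < ∞ ∧ rhoMod μ p (fun x => f x / l) ≤ 1}

/-- The pointwise absolute value of `u`, as a `[0,∞]`-valued function. -/
noncomputable def absFun (u : X → ℝ) : X → ℝ≥0∞ := fun x => ENNReal.ofReal |u x|

/-- The quasi-norm of `L^{p(·)}(X,μ)`. -/
noncomputable def lpNormVar (μ : Measure X) (p : X → ℝ≥0∞) (u : X → ℝ) : ℝ≥0∞ :=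
  luxNorm μ p (absFun u)

/-- The space `L^{p(·)}(X,μ)`. -/
def lpVar (μ : Measure X) (p : X → ℝ≥0∞) : Set (X → ℝ) :=
  {u | Measurable u ∧ ∃ l : ℝ≥0∞, 0 < l ∧ l < ∞ ∧ rhoMod μ p (fun x => l * absFun u x) < ∞}

open Classical in
/-- The `ℓ^q` quasi-norm of a sequence of non-negative numbers indexed by `ℤ`. -/
noncomputable def ellNorm (q : ℝ≥0∞) (a : ℤ → ℝ≥0∞) : ℝ≥0∞ :=
  if q = ∞ then ⨆ k, a k else (∑' k, a k ^ q.toReal) ^ (1 / q.toReal)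

/-- The quasi-norm of `L^{p(·)}(ℓ^{q(·)})`. -/
noncomputable def lpEllNorm (μ : Measure X) (p q : X → ℝ≥0∞) (g : ℤ → X → ℝ≥0∞) : ℝ≥0∞ :=
  luxNorm μ p (fun x => ellNorm (q x) (fun k => g k x))

/-- The semi-modular of `ℓ^{q(·)}(L^{p(·)})`; note that `l ^ (1/∞) = l ^ 0 = 1`. -/
noncomputable def ellLpMod (μ : Measure X) (p q : X → ℝ≥0∞) (g : ℤ → X → ℝ≥0∞) : ℝ≥0∞ :=
  ∑' k : ℤ, sInf {l : ℝ≥0∞ | 0 < l ∧ l < ∞ ∧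
    rhoMod μ p (fun x => g k x / l ^ ((q x)⁻¹).toReal) ≤ 1}

/-- The quasi-norm of `ℓ^{q(·)}(L^{p(·)})`. -/
noncomputable def ellLpNorm (μ : Measure X) (p q : X → ℝ≥0∞) (g : ℤ → X → ℝ≥0∞) : ℝ≥0∞ :=
  sInf {m : ℝ≥0∞ | 0 < m ∧ m < ∞ ∧ ellLpMod μ p q (fun k x => g k x / m) ≤ 1}

/-- `A ↪↪ L^{β(·)}(X,μ)` for a space `A` of functions with quasi-norm `N`: the inclusion is
defined on `A`, and every sequence bounded in `A` has a subsequence that converges in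
`L^{β(·)}(X,μ)`. -/
def CompactlyEmbedsInLp (μ : Measure X) (A : Set (X → ℝ)) (N : (X → ℝ) → ℝ≥0∞)
    (β : X → ℝ≥0∞) : Prop :=
  A ⊆ lpVar μ β ∧
  ∀ v : ℕ → X → ℝ, (∀ n, v n ∈ A) → (∃ C : ℝ≥0∞, C < ∞ ∧ ∀ n, N (v n) ≤ C) →
    ∃ w ∈ lpVar μ β, ∃ θ : ℕ → ℕ, StrictMono θ ∧
      Tendsto (fun n => lpNormVar μ β (fun x => v (θ n) x - w x)) atTop (𝓝 0)

end Exponents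

section Hajlasz

variable {X : Type*} [MetricSpace X] [MeasurableSpace X]

/-- `g = (g_k)_{k ∈ ℤ}` is a vector `s(·)`-gradient of `u`. -/
def IsVectorGradient (μ : Measure X) (s : X → ℝ≥0∞) (u : X → ℝ) (g : ℤ → X → ℝ≥0∞) : Prop :=
  (∀ k, Measurable (g k)) ∧ ∃ N : Set X, μ N = 0 ∧
    ∀ k : ℤ, ∀ x ∉ N, ∀ y ∉ N, (2 : ℝ) ^ (-k - 1) ≤ dist x y → dist x y < (2 : ℝ) ^ (-k) →
      ENNReal.ofReal |u x - u y| ≤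
        ENNReal.ofReal (dist x y ^ (s x).toReal) * g k x +
          ENNReal.ofReal (dist x y ^ (s y).toReal) * g k y

/-- The homogeneous Hajłasz–Triebel–Lizorkin quasi-seminorm. -/
noncomputable def tlSeminorm (μ : Measure X) (s p q : X → ℝ≥0∞) (u : X → ℝ) : ℝ≥0∞ :=
  ⨅ g ∈ {g : ℤ → X → ℝ≥0∞ | IsVectorGradient μ s u g}, lpEllNorm μ p q g

/-- The homogeneous Hajłasz–Besov quasi-seminorm. -/
noncomputable def besovSeminorm (μ : Measure X) (s p q : X → ℝ≥0∞) (u : X → ℝ) : ℝ≥0∞ :=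
  ⨅ g ∈ {g : ℤ → X → ℝ≥0∞ | IsVectorGradient μ s u g}, ellLpNorm μ p q g

/-- The quasi-norm of `M^{s(·)}_{p(·),q(·)}(X,d,μ)`. -/
noncomputable def tlNorm (μ : Measure X) (s p q : X → ℝ≥0∞) (u : X → ℝ) : ℝ≥0∞ :=
  lpNormVar μ p u + tlSeminorm μ s p q u

/-- The quasi-norm of `N^{s(·)}_{p(·),q(·)}(X,d,μ)`. -/
noncomputable def besovNorm (μ : Measure X) (s p q : X → ℝ≥0∞) (u : X → ℝ) : ℝ≥0∞ :=
  lpNormVar μ p u + besovSeminorm μ s p q u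

/-- The Hajłasz–Triebel–Lizorkin space `M^{s(·)}_{p(·),q(·)}(X,d,μ)`.  An almost everywhere finite
function is represented by a real-valued one (put it equal to `0` where it is infinite). -/
def tlSpace (μ : Measure X) (s p q : X → ℝ≥0∞) : Set (X → ℝ) :=
  {u | u ∈ lpVar μ p ∧ tlSeminorm μ s p q u < ∞}

/-- The Hajłasz–Besov space `N^{s(·)}_{p(·),q(·)}(X,d,μ)`. -/
def besovSpace (μ : Measure X) (s p q : X → ℝ≥0∞) : Set (X → ℝ) :=
  {u | u ∈ lpVar μ p ∧ besovSeminorm μ s p q u < ∞}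

/-- The invariant space `M^{s(·),H}_{p(·),q(·)}(X,d,μ)`. -/
def tlSpaceInv (μ : Measure X) (H : Subgroup (X ≃ᵢ X)) (s p q : X → ℝ≥0∞) : Set (X → ℝ) :=
  {u | u ∈ tlSpace μ s p q ∧ ∀ φ ∈ H, u ∘ φ = u}

/-- The invariant space `N^{s(·),H}_{p(·),q(·)}(X,d,μ)`. -/
def besovSpaceInv (μ : Measure X) (H : Subgroup (X ≃ᵢ X)) (s p q : X → ℝ≥0∞) : Set (X → ℝ) :=
  {u | u ∈ besovSpace μ s p q ∧ ∀ φ ∈ H, u ∘ φ = u}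

end Hajlasz

/-! Suppose the limit is not infinite. Then some finite `K` bounds `M_H(x,r)` for all `x` outside
some ball. As `X` is unbounded, there are points `x n` outside that ball tending to infinity. Over
the `r`-neighbourhood of the orbit of `x n` place a tent of height one. These tents are a bounded
family in both invariant spaces but have no subsequence converging in `L^{β(·)}`, so neither
embedding is compact.

Boundedness: `H` permutes each orbit isometrically, so the tents are `H`-invariant; they are also
`1/r`-Lipschitz with values in `[0,1]`. A maximal packing of the orbit by `r`-balls has at most `K`
centres, and as `3r < 1` the unit balls about them cover the support, whose measure is thus at most
`K * ⨆ z, μ (ball z 1)` (`measure_infDist_isoOrbit_lt_le`). Such functions have explicit gradients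
supported in the same set, with uniformly bounded mixed norms (`exists_tlNorm_besovNorm_le`).

No convergence: each tent is at least `1/2` on `ball (x n) (r/2)`, whose measure is bounded below.
Orbits are compact, so this ball eventually leaves the support of any earlier tent. Convergence in
`L^{β(·)}` forces convergence in measure, which is then impossible (`not_tendsto_lpNormVar`). -/

section Exponents

variable {X : Type*} [MeasurableSpace X] {μ : Measure X}

/-! ### Modulars and Luxemburg quasi-norms -/

theorem phiExp_zero {p : ℝ≥0∞} (hp : 0 < p) : phiExp p 0 = 0 := by
  unfold phiExp
  split_ifs with h h'
  · rfl
  · simp at h'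
  · exact ENNReal.zero_rpow_of_pos (ENNReal.toReal_pos hp.ne' h)

theorem phiExp_le_rpow {p t : ℝ≥0∞} {a : ℝ} (ha : ENNReal.ofReal a ≤ p) (ht : t ≤ 1) :
    phiExp p t ≤ t ^ a := by
  unfold phiExp
  split_ifs with h
  · exact zero_le
  · exact ENNReal.rpow_le_rpow_of_exponent_ge ht ((ENNReal.ofReal_le_iff_le_toReal h).1 ha)

theorem rpow_le_phiExp {p t : ℝ≥0∞} {a : ℝ} (ha : ENNReal.ofReal a ≤ p) (ht : 1 < t) :
    t ^ a ≤ phiExp p t := by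
  unfold phiExp
  split_ifs with h h'
  · exact absurd ht h'.not_gt
  · exact le_top
  · exact ENNReal.rpow_le_rpow_of_exponent_le ht.le ((ENNReal.ofReal_le_iff_le_toReal h).1 ha)

theorem exists_ae_ofReal_le_of_essInf_pos {p : X → ℝ≥0∞} (hp : 0 < essInf p μ) :
    ∃ a : ℝ, 0 < a ∧ a ≤ 1 ∧ ∀ᵐ x ∂μ, ENNReal.ofReal a ≤ p x := by
  have hne : min (essInf p μ) 1 ≠ ∞ := ne_top_of_le_ne_top ENNReal.one_ne_top (min_le_right _ _)
  refine ⟨(min (essInf p μ) 1).toReal, ENNReal.toReal_pos (by simp [hp.ne']) hne, ?_, ?_⟩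
  · simpa using ENNReal.toReal_mono ENNReal.one_ne_top (min_le_right (essInf p μ) 1)
  · filter_upwards [ae_essInf_le (f := p) (μ := μ)] with x hx
    rw [ENNReal.ofReal_toReal hne]
    exact (min_le_left _ _).trans hx

/-- Functions dominated by a fixed multiple of the indicator of a set of bounded measure have
bounded Luxemburg quasi-norm. -/
theorem exists_rhoMod_div_le_one {p : X → ℝ≥0∞} (hp : IsExponent μ p) {M C : ℝ≥0∞}
    (hM0 : M ≠ 0) (hM : M ≠ ∞) (hC : C ≠ ∞) :
    ∃ l : ℝ≥0∞, 0 < l ∧ l < ∞ ∧ ∀ S : Set X, MeasurableSet S → μ S ≤ C → ∀ f : X → ℝ≥0∞,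
      (∀ᵐ x ∂μ, f x ≤ S.indicator (fun _ => M) x) → rhoMod μ p (fun x => f x / l) ≤ 1 := by
  obtain ⟨a, ha, -, hpa⟩ := exists_ae_ofReal_le_of_essInf_pos hp.2.2
  have h1C : 1 + C ≠ ∞ := by simp [hC]
  have h1C0 : 1 + C ≠ 0 := by simp
  -- Chosen so that `ε ^ a * C ≤ 1` and `ε ≤ 1`; below one, `phiExp (p x)` is at most the power `a`,
  -- whatever the exponent `p x ≥ a`.
  set ε : ℝ≥0∞ := ((1 + C)⁻¹) ^ (1 / a) with hε
  have hε1 : ε ≤ 1 := ENNReal.rpow_le_one (by simp) (by positivity)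
  have hεt : ε ≠ ∞ := ne_top_of_le_ne_top ENNReal.one_ne_top hε1
  have hε0 : ε ≠ 0 := by
    rw [hε]
    exact (ENNReal.rpow_pos (by simpa using hC) (by simp)).ne'
  have hεa : ε ^ a = (1 + C)⁻¹ := by
    rw [hε, ← ENNReal.rpow_mul, one_div_mul_cancel ha.ne', ENNReal.rpow_one]
  have hMε0 : M / ε ≠ 0 := by simp [ENNReal.div_eq_zero_iff, hM0, hεt]
  have hMεt : M / ε ≠ ∞ := ENNReal.div_ne_top hM hε0
  refine ⟨M / ε, pos_iff_ne_zero.2 hMε0, lt_top_iff_ne_top.2 hMεt, fun S hS hSC f hf => ?_⟩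
  calc rhoMod μ p (fun x => f x / (M / ε))
      ≤ ∫⁻ x, S.indicator (fun _ => ε ^ a) x ∂μ := by
        refine lintegral_mono_ae ?_
        filter_upwards [hf, hpa] with x hfx hpx
        by_cases hx : x ∈ S
        · rw [indicator_of_mem hx] at hfx ⊢
          have h : f x / (M / ε) ≤ ε := by
            rw [ENNReal.div_le_iff hMε0 hMεt, ENNReal.mul_div_cancel hε0 hεt]
            exact hfx
          exact (phiExp_le_rpow hpx (h.trans hε1)).trans (ENNReal.rpow_le_rpow h ha.le)
        · rw [indicator_of_notMem hx] at hfx ⊢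
          rw [nonpos_iff_eq_zero.1 hfx, ENNReal.zero_div, phiExp_zero (hp.2.1 x)]
    _ = (1 + C)⁻¹ * μ S := by rw [lintegral_indicator_const hS, hεa]
    _ ≤ (1 + C)⁻¹ * (1 + C) := by gcongr; exact hSC.trans le_add_self
    _ = 1 := ENNReal.inv_mul_cancel h1C0 h1C

/-- A Chebyshev inequality: small quasi-norm implies small in measure. Only the lower bound `a` of
the exponent matters, since above one `phiExp (p x)` dominates the power `a`. -/
theorem exists_measure_ge_le_of_luxNorm_lt {p : X → ℝ≥0∞} (hp : 0 < essInf p μ) {t ε : ℝ≥0∞}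
    (ht0 : t ≠ 0) (hε : ε ≠ 0) :
    ∃ L : ℝ≥0∞, 0 < L ∧ ∀ f : X → ℝ≥0∞, Measurable f → luxNorm μ p f < L →
      μ {x | t ≤ f x} ≤ ε := by
  obtain ⟨a, ha, -, hpa⟩ := exists_ae_ofReal_le_of_essInf_pos hp
  -- The bound `2⁻¹` makes `η⁻¹ > 1`, and the other one gives `η ^ a ≤ ε`. If `l < t * η`, then `t ≤
  -- f x` forces `f x / l ≥ η⁻¹`.
  set η : ℝ≥0∞ := min (2⁻¹) (ε ^ (1 / a)) with hη
  have hηt : η ≠ ∞ := ne_top_of_le_ne_top (by simp) (min_le_left _ _)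
  have hη0 : η ≠ 0 := by simp [hη, ENNReal.rpow_eq_zero_iff, hε, ha.le, not_lt]
  have hη1 : 1 < η⁻¹ := by
    rw [ENNReal.one_lt_inv]
    exact (min_le_left _ _).trans_lt ENNReal.one_half_lt_one
  have hηa : η ^ a ≤ ε := by
    calc η ^ a ≤ (ε ^ (1 / a)) ^ a := ENNReal.rpow_le_rpow (min_le_right _ _) ha.le
      _ = ε := by rw [← ENNReal.rpow_mul, one_div_mul_cancel ha.ne', ENNReal.rpow_one]
  refine ⟨t * η, by simp [pos_iff_ne_zero, ht0, hη0], fun f hf hlt => ?_⟩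
  obtain ⟨l, ⟨hl0, hlt', hl⟩, hlL⟩ := sInf_lt_iff.1 hlt
  have hE : MeasurableSet {x | t ≤ f x} := measurableSet_le measurable_const hf
  have key : η⁻¹ ^ a * μ {x | t ≤ f x} ≤ 1 := by
    rw [← lintegral_indicator_const hE]
    refine le_trans (lintegral_mono_ae ?_) hl
    filter_upwards [hpa] with x hx
    by_cases hxE : x ∈ {x | t ≤ f x}
    · rw [indicator_of_mem hxE]
      have h : η⁻¹ ≤ f x / l := by
        rw [ENNReal.le_div_iff_mul_le (Or.inl hl0.ne') (Or.inl hlt'.ne)]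
        calc η⁻¹ * l ≤ η⁻¹ * (t * η) := by gcongr
          _ = t := by rw [mul_comm t, ← mul_assoc, ENNReal.inv_mul_cancel hη0 hηt, one_mul]
          _ ≤ f x := hxE
      exact (ENNReal.rpow_le_rpow h ha.le).trans (rpow_le_phiExp hx (hη1.trans_le h))
    · rw [indicator_of_notMem hxE]
      exact zero_le
  refine le_trans ?_ hηa
  have h0 : η ^ a ≠ 0 := (ENNReal.rpow_pos (pos_iff_ne_zero.2 hη0) hηt).ne'
  have h1 : η ^ a ≠ ∞ := ENNReal.rpow_ne_top_of_nonneg ha.le hηt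
  rwa [ENNReal.inv_rpow, mul_comm, ← div_eq_mul_inv, ENNReal.div_le_iff h0 h1, one_mul] at key

/-! ### Mixed quasi-norms of decaying sequences -/

theorem ellNorm_zero {q : ℝ≥0∞} (hq : 0 < q) : ellNorm q (fun _ => 0) = 0 := by
  unfold ellNorm
  split_ifs with h
  · simp
  · have := ENNReal.toReal_pos hq.ne' h
    simp [ENNReal.zero_rpow_of_pos this, this]

theorem tsum_int_rpow_neg_abs_ne_top {δ : ℝ} (hδ : 0 < δ) :
    ∑' k : ℤ, ((2 : ℝ≥0∞) ^ (-(δ * |(k : ℝ)|))) ≠ ∞ := by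
  have hlt : (2 : ℝ≥0∞) ^ (-δ) < 1 :=
    ENNReal.rpow_lt_one_of_one_lt_of_neg (by norm_num) (by linarith)
  have hgeom : ∑' n : ℕ, ((2 : ℝ≥0∞) ^ (-δ)) ^ n ≠ ∞ := by
    rw [ENNReal.tsum_geometric, ENNReal.inv_ne_top]
    exact (tsub_pos_of_lt hlt).ne'
  have hpow : ∀ n : ℕ, ((2 : ℝ≥0∞) ^ (-δ)) ^ n = (2 : ℝ≥0∞) ^ (-(δ * (n : ℝ))) := fun n => by
    rw [← ENNReal.rpow_natCast, ← ENNReal.rpow_mul, neg_mul]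
  rw [tsum_of_nat_of_neg_add_one ENNReal.summable ENNReal.summable]
  refine ENNReal.add_ne_top.2 ⟨?_, ?_⟩
  · refine ne_top_of_le_ne_top hgeom (ENNReal.tsum_le_tsum fun n => ?_)
    rw [hpow]
    simp
  · refine ne_top_of_le_ne_top hgeom (ENNReal.tsum_le_tsum fun n => ?_)
    rw [hpow]
    refine ENNReal.rpow_le_rpow_of_exponent_le (by norm_num) ?_
    have h : |((-((n : ℤ) + 1) : ℤ) : ℝ)| = (n : ℝ) + 1 := by
      push_cast
      rw [abs_neg, abs_of_nonneg (by positivity)]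
    rw [h]
    nlinarith

/-- Geometrically decaying sequences, and bounded sequences when `q = ∞`, are bounded both for the
`ℓ^q` quasi-norm and, after rescaling by a summable sequence of weights, termwise. -/
theorem exists_weights {q : X → ℝ≥0∞} (hq : IsExponent μ q) {A : ℝ≥0∞} (hA0 : A ≠ 0)
    (hA : A ≠ ∞) {δ : ℝ} (hδ : 0 ≤ δ) (hδq : 0 < δ ∨ essInf q μ = ∞) :
    ∃ M : ℝ≥0∞, M ≠ 0 ∧ M ≠ ∞ ∧
      (∀ᵐ x ∂μ, ellNorm (q x) (fun k : ℤ => A * 2 ^ (-(δ * |(k : ℝ)|))) ≤ M) ∧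
      ∃ w : ℤ → ℝ≥0∞, (∀ k, 0 < w k ∧ w k < ∞) ∧ ∑' k, w k ≤ 1 ∧
        ∀ᵐ x ∂μ, ∀ k : ℤ, A * 2 ^ (-(δ * |(k : ℝ)|)) / w k ^ ((q x)⁻¹).toReal ≤ M := by
  have hb1 : ∀ k : ℤ, (2 : ℝ≥0∞) ^ (-(δ * |(k : ℝ)|)) ≤ 1 := fun k => by
    calc (2 : ℝ≥0∞) ^ (-(δ * |(k : ℝ)|)) ≤ 2 ^ (0 : ℝ) :=
          ENNReal.rpow_le_rpow_of_exponent_le (by norm_num)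
            (neg_nonpos.2 (mul_nonneg hδ (abs_nonneg _)))
      _ = 1 := ENNReal.rpow_zero
  have hAb : ∀ k : ℤ, A * (2 : ℝ≥0∞) ^ (-(δ * |(k : ℝ)|)) ≤ A := fun k => by
    calc _ ≤ A * 1 := by gcongr; exact hb1 k
      _ = A := mul_one A
  rcases hδq with hδ' | hqtop
  · obtain ⟨a, ha, -, hqa⟩ := exists_ae_ofReal_le_of_essInf_pos hq.2.2
    -- With `B = ∑ b k ^ a`, the weights `b k ^ a / B` have sum one. They are at most one and `1 / q
    -- x ≤ 1 / a`, so their powers `1 / q x` are at least `b k / B ^ (1 / a)`: dividing by them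
    -- costs only a constant.
    set b : ℤ → ℝ≥0∞ := fun k => (2 : ℝ≥0∞) ^ (-(δ * |(k : ℝ)|)) with hb
    have hb0 : ∀ k, b k ≠ 0 := fun k => by simp [hb, ENNReal.rpow_eq_zero_iff]
    have hbt : ∀ k, b k ≠ ∞ := fun k => ne_top_of_le_ne_top ENNReal.one_ne_top (hb1 k)
    set B : ℝ≥0∞ := ∑' k, b k ^ a with hB
    have hBt : B ≠ ∞ := by
      have hk : ∀ k, b k ^ a = (2 : ℝ≥0∞) ^ (-(δ * a * |(k : ℝ)|)) := fun k => by
        simp only [hb, ← ENNReal.rpow_mul]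
        ring_nf
      rw [hB, tsum_congr hk]
      exact tsum_int_rpow_neg_abs_ne_top (mul_pos hδ' ha)
    have hB1 : 1 ≤ B := by
      calc (1 : ℝ≥0∞) = b 0 ^ a := by simp [hb]
        _ ≤ B := ENNReal.le_tsum (f := fun k => b k ^ a) 0
    have hB0 : B ≠ 0 := (zero_lt_one.trans_le hB1).ne'
    have hAM : A ≤ A * B ^ (1 / a) :=
      le_mul_of_one_le_right zero_le (ENNReal.one_le_rpow hB1 (by positivity))
    refine ⟨A * B ^ (1 / a), fun h => hA0 (nonpos_iff_eq_zero.1 (hAM.trans h.le)),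
      ENNReal.mul_ne_top hA (ENNReal.rpow_ne_top_of_nonneg (by positivity) hBt), ?_,
      fun k => b k ^ a / B, ?_, ?_, ?_⟩
    · filter_upwards [hqa] with x hx
      unfold ellNorm
      split_ifs with h
      · exact iSup_le fun k => (hAb k).trans hAM
      · have hax : a ≤ (q x).toReal := (ENNReal.ofReal_le_iff_le_toReal h).1 hx
        have hq0 : 0 < (q x).toReal := ha.trans_le hax
        calc (∑' k, (A * b k) ^ (q x).toReal) ^ (1 / (q x).toReal)
            ≤ (A ^ (q x).toReal * B) ^ (1 / (q x).toReal) := by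
              refine ENNReal.rpow_le_rpow ?_ (by positivity)
              rw [hB, ← ENNReal.tsum_mul_left]
              refine ENNReal.tsum_le_tsum fun k => ?_
              rw [ENNReal.mul_rpow_of_nonneg _ _ hq0.le]
              gcongr _ * ?_
              exact ENNReal.rpow_le_rpow_of_exponent_ge (hb1 k) hax
          _ = A * B ^ (1 / (q x).toReal) := by
              rw [ENNReal.mul_rpow_of_nonneg _ _ (by positivity), ← ENNReal.rpow_mul,
                mul_one_div_cancel hq0.ne', ENNReal.rpow_one]
          _ ≤ A * B ^ (1 / a) := by
              gcongr _ * ?_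
              exact ENNReal.rpow_le_rpow_of_exponent_le hB1 (one_div_le_one_div_of_le ha hax)
    · intro k
      have h1 : b k ^ a ≠ ∞ := ENNReal.rpow_ne_top_of_nonneg ha.le (hbt k)
      exact ⟨ENNReal.div_pos (ENNReal.rpow_pos (pos_iff_ne_zero.2 (hb0 k)) (hbt k)).ne' hBt,
        (ENNReal.div_ne_top h1 hB0).lt_top⟩
    · simp_rw [div_eq_mul_inv]
      rw [ENNReal.tsum_mul_right, ← hB, ENNReal.mul_inv_cancel hB0 hBt]
    · filter_upwards [hqa] with x hx k
      have hw1 : b k ^ a / B ≤ 1 := by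
        rw [ENNReal.div_le_iff hB0 hBt, one_mul]
        exact ENNReal.le_tsum (f := fun k => b k ^ a) k
      have hexp : ((q x)⁻¹).toReal ≤ 1 / a := by
        have h : (q x)⁻¹ ≤ ENNReal.ofReal (1 / a) := by
          rw [one_div, ENNReal.ofReal_inv_of_pos ha]
          exact ENNReal.inv_le_inv.2 hx
        exact ENNReal.toReal_le_of_le_ofReal (by positivity) h
      have hroot : b k / B ^ (1 / a) ≤ (b k ^ a / B) ^ ((q x)⁻¹).toReal := by
        calc b k / B ^ (1 / a) = (b k ^ a / B) ^ (1 / a) := by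
              rw [ENNReal.div_rpow_of_nonneg _ _ (by positivity), ← ENNReal.rpow_mul,
                mul_one_div_cancel ha.ne', ENNReal.rpow_one]
          _ ≤ _ := ENNReal.rpow_le_rpow_of_exponent_ge hw1 hexp
      have hBa0 : B ^ (1 / a) ≠ 0 := (ENNReal.rpow_pos (pos_iff_ne_zero.2 hB0) hBt).ne'
      have hBat : B ^ (1 / a) ≠ ∞ := ENNReal.rpow_ne_top_of_nonneg (by positivity) hBt
      calc A * b k / (b k ^ a / B) ^ ((q x)⁻¹).toReal
          ≤ A * b k / (b k / B ^ (1 / a)) := ENNReal.div_le_div_left hroot _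
        _ ≤ A * B ^ (1 / a) := by
            rw [ENNReal.div_le_iff (ENNReal.div_pos (hb0 k) hBat).ne'
              (ENNReal.div_ne_top (hbt k) hBa0), mul_assoc, ENNReal.mul_div_cancel hBa0 hBat]
  -- Here `q = ∞` almost everywhere, so the weights enter with exponent `0` and any summable
  -- positive sequence serves.
  · have hqx : ∀ᵐ x ∂μ, q x = ∞ := by
      filter_upwards [ae_essInf_le (f := q) (μ := μ)] with x hx
      rwa [hqtop, top_le_iff] at hx
    obtain ⟨w, hw0, hw1⟩ := ENNReal.exists_pos_sum_of_countable' one_ne_zero ℤ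
    refine ⟨A, hA0, hA, ?_, w, fun k => ⟨hw0 k, ?_⟩, hw1.le, ?_⟩
    · filter_upwards [hqx] with x hx
      rw [hx, ellNorm, if_pos rfl]
      exact iSup_le hAb
    · exact ((ENNReal.le_tsum k).trans_lt hw1).trans ENNReal.one_lt_top
    · filter_upwards [hqx] with x hx k
      simpa [hx] using hAb k

/-- Sequences supported in a common set of bounded measure, and dominated on it by a suitable
fixed sequence, are bounded in `L^{p(·)}(ℓ^{q(·)})` and in `ℓ^{q(·)}(L^{p(·)})`. -/
theorem exists_mixedNorm_indicator_le {p q : X → ℝ≥0∞} (hp : IsExponent μ p)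
    (hq : IsExponent μ q) {A C : ℝ≥0∞} (hA0 : A ≠ 0) (hA : A ≠ ∞) (hC : C ≠ ∞) {δ : ℝ}
    (hδ : 0 ≤ δ) (hδq : 0 < δ ∨ essInf q μ = ∞) :
    ∃ l : ℝ≥0∞, l < ∞ ∧ ∀ S : Set X, MeasurableSet S → μ S ≤ C →
      lpEllNorm μ p q (fun k : ℤ => S.indicator fun _ => A * 2 ^ (-(δ * |(k : ℝ)|))) ≤ l ∧
      ellLpNorm μ p q (fun k : ℤ => S.indicator fun _ => A * 2 ^ (-(δ * |(k : ℝ)|))) ≤ l := by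
  obtain ⟨M, hM0, hM, hell, w, hw, hw1, hwM⟩ := exists_weights hq hA0 hA hδ hδq
  obtain ⟨l, hl0, hlt, hl⟩ := exists_rhoMod_div_le_one hp hM0 hM hC
  refine ⟨l, hlt, fun S hS hSC => ⟨sInf_le ⟨hl0, hlt, hl S hS hSC _ ?_⟩,
    sInf_le ⟨hl0, hlt, le_trans (ENNReal.tsum_le_tsum fun k => ?_) hw1⟩⟩⟩
  · filter_upwards [hell] with x hx
    by_cases hxS : x ∈ S
    · simpa only [indicator_of_mem hxS] using hx
    · simp only [indicator_of_notMem hxS]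
      exact (ellNorm_zero (hq.2.1 x)).le
  · refine sInf_le ⟨(hw k).1, (hw k).2, ?_⟩
    -- Exchanging the two divisions leaves a function bounded by `M` on `S`, divided by `l`.
    simp only [div_eq_mul_inv]
    simp_rw [mul_right_comm _ l⁻¹]
    refine hl S hS hSC _ ?_
    filter_upwards [hwM] with x hx
    by_cases hxS : x ∈ S
    · simpa only [indicator_of_mem hxS, ← div_eq_mul_inv] using hx k
    · simp only [indicator_of_notMem hxS, zero_mul, le_refl]

end Exponents

/-! ### Gradients of Lipschitz functions -/

section Hajlasz

/-- At small scales the Lipschitz bound `Λ * d` is used, at large scales the bound `1`. Keeping `t`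
between `δ` and `1 - δ` leaves a spare factor `d ^ δ` or `d ^ (-δ)`, hence decay in `|k|` at both
ends. -/
theorem min_one_mul_le_rpow_mul {Λ d σ δ t : ℝ} (hΛ : 0 ≤ Λ) (hδ : 0 ≤ δ) (hδσ : δ ≤ σ)
    (hσ : σ ≤ 1) (hσt : σ ≤ t) (ht : t ≤ 1 - δ) {k : ℤ} (hk : (2 : ℝ) ^ (-k - 1) ≤ d)
    (hk' : d < (2 : ℝ) ^ (-k)) :
    min 1 (Λ * d) ≤ d ^ t * ((Λ + 2) * 2 ^ (-(δ * |(k : ℝ)|))) := by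
  have hd : 0 < d := lt_of_lt_of_le (by positivity) hk
  rcases le_or_gt 0 k with h0 | h0
  · have hd1 : d ≤ 1 := hk'.le.trans (zpow_le_one_of_nonpos₀ (by norm_num) (by omega))
    have h1 : d ^ δ ≤ 2 ^ (-(δ * |(k : ℝ)|)) := by
      calc d ^ δ ≤ ((2 : ℝ) ^ (-k)) ^ δ := Real.rpow_le_rpow hd.le hk'.le hδ
        _ = 2 ^ (-(δ * |(k : ℝ)|)) := by
          rw [← Real.rpow_intCast, ← Real.rpow_mul (by norm_num),
            abs_of_nonneg (by exact_mod_cast h0)]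
          push_cast
          ring_nf
    calc min 1 (Λ * d) ≤ Λ * d := min_le_right _ _
      _ = Λ * d ^ (1 : ℝ) := by rw [Real.rpow_one]
      _ ≤ Λ * d ^ (t + δ) := by
        gcongr Λ * ?_
        exact Real.rpow_le_rpow_of_exponent_ge hd hd1 (by linarith)
      _ = d ^ t * (Λ * d ^ δ) := by rw [Real.rpow_add hd]; ring
      _ ≤ d ^ t * ((Λ + 2) * 2 ^ (-(δ * |(k : ℝ)|))) := by
        gcongr
        linarith
  · have hd1 : 1 ≤ d := le_trans (one_le_zpow₀ (by norm_num) (by omega)) hk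
    have h1 : (2 : ℝ) ^ (-(k : ℝ) * δ - δ) ≤ d ^ t := by
      calc (2 : ℝ) ^ (-(k : ℝ) * δ - δ) = ((2 : ℝ) ^ (-k - 1)) ^ δ := by
            rw [← Real.rpow_intCast, ← Real.rpow_mul (by norm_num)]
            push_cast
            ring_nf
        _ ≤ d ^ δ := Real.rpow_le_rpow (by positivity) hk hδ
        _ ≤ d ^ t := Real.rpow_le_rpow_of_exponent_le hd1 (hδσ.trans hσt)
    have h2 : (2 : ℝ) ^ (-(k : ℝ) * δ - δ) * 2 ^ (-(δ * |(k : ℝ)|)) = 2 ^ (-δ) := by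
      rw [← Real.rpow_add (by norm_num), abs_of_neg (by exact_mod_cast h0)]
      ring_nf
    -- The lower end `2 ^ (-k - 1)` of the shell loses a factor `2 ^ (-δ)`, at least `1/2` because
    -- `δ ≤ 1`; the `2` in `Λ + 2` makes up for it.
    have h3 : (2 : ℝ)⁻¹ ≤ 2 ^ (-δ) := by
      rw [← Real.rpow_neg_one]
      exact Real.rpow_le_rpow_of_exponent_le (by norm_num) (by linarith)
    calc min 1 (Λ * d) ≤ 1 := min_le_left _ _
      _ = 2⁻¹ * 2 := by norm_num
      _ ≤ 2 ^ (-δ) * (Λ + 2) := by gcongr; linarith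
      _ = (2 : ℝ) ^ (-(k : ℝ) * δ - δ) * ((Λ + 2) * 2 ^ (-(δ * |(k : ℝ)|))) := by rw [← h2]; ring
      _ ≤ _ := by gcongr

variable {X : Type*} [MetricSpace X] [MeasurableSpace X] {μ : Measure X}

/-- If one of the two points lies in `S`, its term alone dominates the difference; if neither does,
the difference vanishes. Hence the gradient may be cut off outside `S`. -/
theorem isVectorGradient_indicator {s : X → ℝ≥0∞} {Λ σ δ : ℝ} (hΛ : 0 ≤ Λ) (hδ : 0 ≤ δ)
    (hδσ : δ ≤ σ) (hσ : σ ≤ 1) (hs : ∀ᵐ x ∂μ, σ ≤ (s x).toReal ∧ (s x).toReal ≤ 1 - δ)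
    {S : Set X} (hS : MeasurableSet S) {u : X → ℝ} (hu : ∀ x y, |u x - u y| ≤ 1)
    (huΛ : ∀ x y, |u x - u y| ≤ Λ * dist x y) (huS : ∀ x ∉ S, u x = 0) :
    IsVectorGradient μ s u
      (fun k : ℤ => S.indicator fun _ => ENNReal.ofReal (Λ + 2) * 2 ^ (-(δ * |(k : ℝ)|))) := by
  refine ⟨fun k => measurable_const.indicator hS, _, ae_iff.1 hs, ?_⟩
  intro k x hx y hy hk hk'
  simp only [mem_ofPred_eq, not_not] at hx hy
  have key : ∀ z, (σ ≤ (s z).toReal ∧ (s z).toReal ≤ 1 - δ) → z ∈ S →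
      ENNReal.ofReal |u x - u y| ≤ ENNReal.ofReal (dist x y ^ (s z).toReal) *
        S.indicator (fun _ => ENNReal.ofReal (Λ + 2) * 2 ^ (-(δ * |(k : ℝ)|))) z := by
    intro z hz hzS
    have h2 : (2 : ℝ≥0∞) ^ (-(δ * |(k : ℝ)|)) = ENNReal.ofReal (2 ^ (-(δ * |(k : ℝ)|))) := by
      rw [← ENNReal.ofReal_rpow_of_pos (by norm_num), ENNReal.ofReal_ofNat]
    rw [indicator_of_mem hzS, h2, ← ENNReal.ofReal_mul (by linarith),
      ← ENNReal.ofReal_mul (Real.rpow_nonneg dist_nonneg _)]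
    exact ENNReal.ofReal_le_ofReal ((le_min (hu x y) (huΛ x y)).trans
      (min_one_mul_le_rpow_mul hΛ hδ hδσ hσ hz.1 hz.2 hk hk'))
  by_cases hxS : x ∈ S
  · exact (key x hx hxS).trans le_self_add
  by_cases hyS : y ∈ S
  · exact (key y hy hyS).trans le_add_self
  · simp [huS x hxS, huS y hyS]

/-- Uniformly Lipschitz functions with values in `[0,1]` and supports of bounded measure form
bounded families in the Hajłasz–Triebel–Lizorkin and the Hajłasz–Besov spaces. -/
theorem exists_tlNorm_besovNorm_le {s p q : X → ℝ≥0∞} (hs : IsBddExponent μ s)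
    (hp : IsExponent μ p) (hq : IsExponent μ q)
    (hsq : (essSup s μ < 1 ∧ essInf q μ < ∞) ∨ (essSup s μ ≤ 1 ∧ essInf q μ = ∞))
    {Λ : ℝ} (hΛ : 0 ≤ Λ) {C : ℝ≥0∞} (hC : C ≠ ∞) :
    ∃ K : ℝ≥0∞, K < ∞ ∧ ∀ S : Set X, MeasurableSet S → μ S ≤ C → ∀ u : X → ℝ, Measurable u →
      (∀ x, 0 ≤ u x) → (∀ x, u x ≤ 1) → (∀ x y, |u x - u y| ≤ Λ * dist x y) →
      (∀ x ∉ S, u x = 0) →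
      (u ∈ tlSpace μ s p q ∧ tlNorm μ s p q u ≤ K) ∧
        (u ∈ besovSpace μ s p q ∧ besovNorm μ s p q u ≤ K) := by
  obtain ⟨σ, hσ0, hσ1, hσ⟩ := exists_ae_ofReal_le_of_essInf_pos hs.1.2.2
  have hs1 : essSup s μ ≤ 1 := hsq.elim (fun h => h.1.le) fun h => h.1
  have hst : essSup s μ ≠ ∞ := hs.2.ne
  obtain ⟨δ, hδ, hδσ, hδs, hδq⟩ : ∃ δ : ℝ, 0 ≤ δ ∧ δ ≤ σ ∧ δ ≤ 1 - (essSup s μ).toReal ∧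
      (0 < δ ∨ essInf q μ = ∞) := by
    -- When `s⁺ < 1` there is room for geometric decay. When `q⁻ = ∞` no decay is needed, so `δ = 0`
    -- allows `s⁺ = 1`.
    rcases hsq with h | h
    · have h1 : (essSup s μ).toReal < 1 := by
        simpa using (ENNReal.toReal_lt_toReal hst ENNReal.one_ne_top).2 h.1
      have h2 : 0 < min σ (1 - (essSup s μ).toReal) := lt_min hσ0 (by linarith)
      exact ⟨_, h2.le, min_le_left _ _, min_le_right _ _, Or.inl h2⟩
    · have h1 : (essSup s μ).toReal ≤ 1 := by
        simpa using (ENNReal.toReal_le_toReal hst ENNReal.one_ne_top).2 h.1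
      exact ⟨0, le_rfl, hσ0.le, by linarith, Or.inr h.2⟩
  have hsx : ∀ᵐ x ∂μ, σ ≤ (s x).toReal ∧ (s x).toReal ≤ 1 - δ := by
    filter_upwards [hσ, ENNReal.ae_le_essSup (μ := μ) s] with x h1 h2
    have hxt : s x ≠ ∞ := ne_top_of_le_ne_top hst h2
    have := ENNReal.toReal_mono hst h2
    exact ⟨(ENNReal.ofReal_le_iff_le_toReal hxt).1 h1, by linarith⟩
  obtain ⟨l, hlt, hl⟩ := exists_mixedNorm_indicator_le (A := ENNReal.ofReal (Λ + 2)) hp hq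
    (by simp; linarith) ENNReal.ofReal_ne_top hC hδ hδq
  obtain ⟨l', hl0', hlt', hl'⟩ := exists_rhoMod_div_le_one hp one_ne_zero ENNReal.one_ne_top hC
  refine ⟨l' + l, ENNReal.add_lt_top.2 ⟨hlt', hlt⟩, fun S hS hSC u hum hu0 hu1 huΛ huS => ?_⟩
  have hrho : rhoMod μ p (fun x => absFun u x / l') ≤ 1 := by
    refine hl' S hS hSC _ (Eventually.of_forall fun x => ?_)
    by_cases hx : x ∈ S
    · rw [indicator_of_mem hx, absFun, abs_of_nonneg (hu0 x)]
      exact ENNReal.ofReal_le_one.2 (hu1 x)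
    · simp [absFun, huS x hx]
  have hlp : u ∈ lpVar μ p := by
    refine ⟨hum, l'⁻¹, ENNReal.inv_pos.2 hlt'.ne, ENNReal.inv_lt_top.2 hl0', ?_⟩
    simp_rw [mul_comm l'⁻¹, ← div_eq_mul_inv]
    exact hrho.trans_lt ENNReal.one_lt_top
  have hnorm : lpNormVar μ p u ≤ l' := sInf_le ⟨hl0', hlt', hrho⟩
  have hgrad := isVectorGradient_indicator hΛ hδ hδσ hσ1 hsx hS
    (fun x y => abs_sub_le_iff.2 ⟨by linarith [hu0 y, hu1 x], by linarith [hu0 x, hu1 y]⟩) huΛ huS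
  have htl : tlSeminorm μ s p q u ≤ l := (iInf₂_le _ hgrad).trans (hl S hS hSC).1
  have hbes : besovSeminorm μ s p q u ≤ l := (iInf₂_le _ hgrad).trans (hl S hS hSC).2
  exact ⟨⟨⟨hlp, htl.trans_lt hlt⟩, add_le_add hnorm htl⟩,
    ⟨⟨hlp, hbes.trans_lt hlt⟩, add_le_add hnorm hbes⟩⟩

end Hajlasz

/-! ### Orbits, packings and tents -/

section Orbits

variable {X : Type*} [MetricSpace X]

theorem mem_isoOrbit_self (H : Subgroup (X ≃ᵢ X)) (x : X) : x ∈ isoOrbit H x :=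
  ⟨1, H.one_mem, rfl⟩

/-- Evaluation at `x` is continuous for pointwise convergence. Boundedness of orbits is what lets
the balls escape from earlier tents. -/
theorem IsCompactIsoSubgroup.isCompact_isoOrbit {H : Subgroup (X ≃ᵢ X)}
    (hH : IsCompactIsoSubgroup H) (x : X) : IsCompact (isoOrbit H x) := by
  let _ : TopologicalSpace (X ≃ᵢ X) :=
    TopologicalSpace.induced (fun φ : X ≃ᵢ X => (φ : X → X)) Pi.topologicalSpace
  have hc : Continuous fun φ : X ≃ᵢ X => φ x := (continuous_apply x).comp continuous_induced_dom
  exact IsCompact.image (s := (H : Set (X ≃ᵢ X))) hH hc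

theorem infDist_isoOrbit_apply {H : Subgroup (X ≃ᵢ X)} {φ : X ≃ᵢ X} (hφ : φ ∈ H) (x y : X) :
    infDist (φ y) (isoOrbit H x) = infDist y (isoOrbit H x) := by
  have h : φ '' isoOrbit H x = isoOrbit H x := by
    ext z
    constructor
    · rintro ⟨_, ⟨h, hh, rfl⟩, rfl⟩
      exact ⟨φ * h, H.mul_mem hφ hh, rfl⟩
    · rintro ⟨h, hh, rfl⟩
      exact ⟨φ⁻¹ (h x), ⟨φ⁻¹ * h, H.mul_mem (H.inv_mem hφ) hh, rfl⟩, φ.apply_symm_apply _⟩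
  conv_lhs => rw [← h]
  exact infDist_image φ.isometry

/-- If `M_H(x,r) ≤ K`, then at most `K` balls of radius `2r` cover the orbit of `x`. -/
theorem exists_finset_cover_isoOrbit {H : Subgroup (X ≃ᵢ X)} {x : X} {r : ℝ} (hr : 0 < r) {K : ℕ}
    (hK : orbitPacking H x r ≤ K) :
    ∃ A : Finset X, A.card ≤ K ∧ ∀ y ∈ isoOrbit H x, ∃ a ∈ A, dist y a < 2 * r := by
  obtain ⟨A, hA⟩ := zorn_subset {A : Set X | A ⊆ isoOrbit H x ∧
      ∀ ξ ∈ A, ∀ η ∈ A, ξ ≠ η → ball ξ r ∩ ball η r = ∅} (by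
    intro c hc hchain
    refine ⟨⋃₀ c, ⟨sUnion_subset fun B hB => (hc hB).1, ?_⟩, fun B hB => subset_sUnion_of_mem hB⟩
    rintro ξ ⟨B, hB, hξ⟩ η ⟨B', hB', hη⟩ hne
    rcases hchain.total hB hB' with h | h
    · exact (hc hB').2 ξ (h hξ) η hη hne
    · exact (hc hB).2 ξ hξ η (h hη) hne)
  have hcard : A.encard ≤ K := (le_iSup₂ (f := fun B (_ : B ∈ _) => B.encard) A hA.prop).trans hK
  have hfin : A.Finite := finite_of_encard_le_coe hcard
  refine ⟨hfin.toFinset, ?_, fun y hy => ?_⟩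
  · rw [hfin.encard_eq_coe_toFinset_card] at hcard
    exact_mod_cast hcard
  by_contra! hfar
  have hfar' : ∀ a ∈ A, ball y r ∩ ball a r = ∅ := fun a ha => by
    rw [← disjoint_iff_inter_eq_empty]
    exact ball_disjoint_ball (by linarith [hfar a (hfin.mem_toFinset.2 ha)])
  -- A point at distance at least `2r` from all of `A` could be added to the packing; maximality
  -- puts it in `A`, at distance `0` from itself.
  have hins : insert y A ⊆ A := by
    refine hA.le_of_ge ⟨insert_subset hy hA.prop.1, ?_⟩ (subset_insert y A)
    rintro ξ (rfl | hξ) η (rfl | hη) hne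
    · exact absurd rfl hne
    · exact hfar' η hη
    · rw [inter_comm]
      exact hfar' ξ hξ
    · exact hA.prop.2 ξ hξ η hη hne
  have := hfar y (hfin.mem_toFinset.2 (hins (mem_insert y A)))
  rw [dist_self] at this
  linarith

/-- The tent function of height one over the `r`-neighbourhood of the orbit of `x`. -/
noncomputable def orbitTent (H : Subgroup (X ≃ᵢ X)) (r : ℝ) (x y : X) : ℝ :=
  max 0 (1 - infDist y (isoOrbit H x) / r)

variable {H : Subgroup (X ≃ᵢ X)} {r : ℝ} {x : X}

theorem continuous_orbitTent : Continuous (orbitTent H r x) :=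
  continuous_const.max (continuous_const.sub ((continuous_infDist_pt _).div_const _))

theorem orbitTent_nonneg (y : X) : 0 ≤ orbitTent H r x y := le_max_left _ _

theorem orbitTent_le_one (hr : 0 < r) (y : X) : orbitTent H r x y ≤ 1 :=
  max_le zero_le_one (sub_le_self _ (div_nonneg infDist_nonneg hr.le))

theorem abs_orbitTent_sub_le (hr : 0 < r) (y z : X) :
    |orbitTent H r x y - orbitTent H r x z| ≤ r⁻¹ * dist y z := by
  have h1 : |infDist y (isoOrbit H x) - infDist z (isoOrbit H x)| ≤ dist y z := by
    simpa [Real.dist_eq] using (lipschitz_infDist_pt (isoOrbit H x)).dist_le_mul y z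
  calc |orbitTent H r x y - orbitTent H r x z|
      ≤ |(1 - infDist y (isoOrbit H x) / r) - (1 - infDist z (isoOrbit H x) / r)| := by
        simpa [orbitTent] using abs_max_sub_max_le_max 0 (1 - infDist y (isoOrbit H x) / r) 0
          (1 - infDist z (isoOrbit H x) / r)
    _ = r⁻¹ * |infDist y (isoOrbit H x) - infDist z (isoOrbit H x)| := by
        rw [show 1 - infDist y (isoOrbit H x) / r - (1 - infDist z (isoOrbit H x) / r) =
          r⁻¹ * (infDist z (isoOrbit H x) - infDist y (isoOrbit H x)) by ring, abs_mul,
          abs_of_pos (inv_pos.2 hr), abs_sub_comm]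
    _ ≤ r⁻¹ * dist y z := by gcongr

theorem orbitTent_eq_zero (hr : 0 < r) {y : X} (hy : r ≤ infDist y (isoOrbit H x)) :
    orbitTent H r x y = 0 :=
  max_eq_left (sub_nonpos.2 ((one_le_div hr).2 hy))

theorem half_le_orbitTent (hr : 0 < r) {y : X} (hy : dist y x < r / 2) :
    1 / 2 ≤ orbitTent H r x y := by
  have h : infDist y (isoOrbit H x) / r ≤ 1 / 2 := by
    rw [div_le_iff₀ hr]
    linarith [infDist_le_dist_of_mem (x := y) (mem_isoOrbit_self H x)]
  exact le_max_of_le_right (by linarith)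

theorem orbitTent_comp {φ : X ≃ᵢ X} (hφ : φ ∈ H) : orbitTent H r x ∘ φ = orbitTent H r x := by
  funext y
  simp only [Function.comp, orbitTent, infDist_isoOrbit_apply hφ]

theorem measure_infDist_isoOrbit_lt_le [MeasurableSpace X] (μ : Measure X) (hr : 0 < r)
    (hr3 : r < 1 / 3) {K : ℕ} (hK : orbitPacking H x r ≤ K) :
    μ {y | infDist y (isoOrbit H x) < r} ≤ K * ⨆ z : X, μ (ball z 1) := by
  obtain ⟨A, hAK, hA⟩ := exists_finset_cover_isoOrbit hr hK
  calc μ {y | infDist y (isoOrbit H x) < r} ≤ μ (⋃ a ∈ A, ball a 1) := by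
        refine measure_mono fun y hy => ?_
        obtain ⟨z, hz, hyz⟩ := (infDist_lt_iff ⟨x, mem_isoOrbit_self H x⟩).1 hy
        obtain ⟨a, ha, hza⟩ := hA z hz
        exact mem_iUnion₂.2 ⟨a, ha, by rw [mem_ball]; linarith [dist_triangle y z a]⟩
    _ ≤ ∑ a ∈ A, μ (ball a 1) := measure_biUnion_finset_le _ _
    _ ≤ ∑ _a ∈ A, ⨆ z : X, μ (ball z 1) :=
        Finset.sum_le_sum fun a _ => le_iSup (fun z => μ (ball z 1)) a
    _ ≤ K * ⨆ z : X, μ (ball z 1) := by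
        rw [Finset.sum_const, nsmul_eq_mul]
        gcongr

end Orbits

/-! ### Failure of compactness -/

/-- A sequence of functions that are at least `1/2` on balls of measure bounded below escaping from
the supports of the previous functions has no subsequence converging in `L^{β(·)}`. -/
theorem not_tendsto_lpNormVar {X : Type*} [MetricSpace X] [MeasurableSpace X] [BorelSpace X]
    {μ : Measure X} {β : X → ℝ≥0∞} (hβ : IsExponent μ β) {r : ℝ} {x : ℕ → X} {c : ℝ≥0∞}
    (hc0 : c ≠ 0) (hct : c ≠ ∞) (hc : ∀ n, c ≤ μ (ball (x n) r)) {v : ℕ → X → ℝ}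
    (hvm : ∀ n, Measurable (v n)) (hv : ∀ n, ∀ y ∈ ball (x n) r, 1 / 2 ≤ v n y)
    (hsep : ∀ m, ∀ᶠ n in atTop, ∀ y ∈ ball (x n) r, v m y = 0) {w : X → ℝ} (hw : Measurable w) :
    ¬ Tendsto (fun n => lpNormVar μ β (fun y => v n y - w y)) atTop (𝓝 0) := by
  intro hlim
  have hε : c / 3 ≠ 0 := by simp [ENNReal.div_eq_zero_iff, hc0]
  obtain ⟨L, hL, hLf⟩ := exists_measure_ge_le_of_luxNorm_lt (t := ENNReal.ofReal (1 / 4)) hβ.2.2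
    (by simp) hε
  have hsmall : ∀ᶠ n in atTop, μ {y | 1 / 4 ≤ |v n y - w y|} ≤ c / 3 := by
    filter_upwards [hlim.eventually (gt_mem_nhds hL)] with n hn
    have h := hLf (absFun fun y => v n y - w y) ((hvm n).sub hw).abs.ennreal_ofReal hn
    simpa only [absFun, ENNReal.ofReal_le_ofReal_iff (abs_nonneg _)] using h
  obtain ⟨m, hm⟩ := hsmall.exists
  obtain ⟨n, hn, hmn⟩ := (hsmall.and (hsep m)).exists
  -- On the ball `v n - v m ≥ 1/2`, so `w` cannot be within `1/4` of both. Two sets of measure at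
  -- most `c / 3` would then cover a set of measure at least `c`.
  have hsub : ball (x n) r ⊆ {y | 1 / 4 ≤ |v n y - w y|} ∪ {y | 1 / 4 ≤ |v m y - w y|} := by
    intro y hy
    by_contra hcon
    simp only [mem_union, mem_ofPred_eq, not_or, not_le, abs_lt] at hcon
    have h1 := hv n y hy
    have h2 := hmn y hy
    linarith [hcon.1.2, hcon.2.1]
  have hle : c ≤ c / 3 + c / 3 :=
    (hc n).trans ((measure_mono hsub).trans ((measure_union_le _ _).trans (add_le_add hn hm)))
  have hlt : c / 3 + c / 3 < c := by
    calc c / 3 + c / 3 < c / 3 + c / 3 + c / 3 :=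
          ENNReal.lt_add_right (by finiteness) hε
      _ = c := ENNReal.add_thirds c
  exact hle.not_gt hlt

theorem mainTheorem4 {X : Type*} [MetricSpace X] [MeasurableSpace X] [BorelSpace X]
    (μ : Measure X)
    (hball : ∀ (x : X) (r : ℝ), 0 < r → 0 < μ (ball x r) ∧ μ (ball x r) < ∞)
    (hunb : ¬ Bornology.IsBounded (Set.univ : Set X))
    (hsup : (⨆ x : X, μ (ball x 1)) < ∞)
    (hinf : ∀ r ∈ Ioo (0 : ℝ) 1, 0 < ⨅ x : X, μ (ball x r))
    (H : Subgroup (X ≃ᵢ X)) (hH : H ≤ isoMu μ) (hHc : IsCompactIsoSubgroup H)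
    (s p β q : X → ℝ≥0∞)
    (hs : IsBddExponent μ s) (hp : IsBddExponent μ p) (hβ : IsBddExponent μ β)
    (hq : IsExponent μ q)
    (hsq : (essSup s μ < 1 ∧ essInf q μ < ∞) ∨ (essSup s μ ≤ 1 ∧ essInf q μ = ∞))
    (hemb : CompactlyEmbedsInLp μ (tlSpaceInv μ H s p q) (tlNorm μ s p q) β ∨
      CompactlyEmbedsInLp μ (besovSpaceInv μ H s p q) (besovNorm μ s p q) β) :
    ∀ (x₀ : X), ∀ r ∈ Ioo (0 : ℝ) (1 / 3),
      Tendsto (fun R : ℝ => ⨆ x ∈ (ball x₀ R)ᶜ, orbitPacking H x r) atTop (𝓝 ⊤) := by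
  rintro x₀ r ⟨hr, hr3⟩
  rw [ENat.tendsto_nhds_top_iff_natCast_lt]
  by_contra! hcon
  obtain ⟨K, hK⟩ := hcon
  obtain ⟨R, hR⟩ := hK.exists
  have hpack : ∀ x, R ≤ dist x x₀ → orbitPacking H x r ≤ K := fun x hx =>
    (le_iSup₂ (f := fun x (_ : x ∈ (ball x₀ R)ᶜ) => orbitPacking H x r) x
      (by simpa using hx)).trans hR
  have hfar : ∀ n : ℕ, ∃ x, max R n ≤ dist x x₀ := fun n => by
    by_contra! h
    exact hunb ((isBounded_ball (x := x₀) (r := max R n)).subset fun x _ => h x)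
  choose x hx using hfar
  have hC : (K : ℝ≥0∞) * ⨆ z : X, μ (ball z 1) ≠ ∞ :=
    ENNReal.mul_ne_top (ENNReal.natCast_ne_top K) hsup.ne
  obtain ⟨B, hB, hbound⟩ := exists_tlNorm_besovNorm_le hs hp.1 hq hsq (inv_nonneg.2 hr.le) hC
  set v : ℕ → X → ℝ := fun n => orbitTent H r (x n) with hv
  have hvm : ∀ n, Measurable (v n) := fun n => continuous_orbitTent.measurable
  have hvB := fun n => hbound {y | infDist y (isoOrbit H (x n)) < r}
    (isOpen_lt (continuous_infDist_pt _) continuous_const).measurableSet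
    (measure_infDist_isoOrbit_lt_le μ hr hr3 (hpack _ ((le_max_left _ _).trans (hx n))))
    (v n) (hvm n) orbitTent_nonneg (orbitTent_le_one hr) (abs_orbitTent_sub_le hr)
    (fun y hy => orbitTent_eq_zero hr (not_lt.1 hy))
  have hvH : ∀ n, ∀ φ ∈ H, v n ∘ φ = v n := fun n φ hφ => orbitTent_comp hφ
  have hsep : ∀ m, ∀ᶠ n in atTop, ∀ y ∈ ball (x n) (r / 2), v m y = 0 := by
    intro m
    obtain ⟨D, hD⟩ := (hHc.isCompact_isoOrbit (x m)).isBounded.subset_ball x₀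
    -- A point of the ball within `r` of the orbit of `x m` would give `dist (x n) x₀ < r/2 + r + D
    -- < D + 1`.
    filter_upwards [eventually_ge_atTop ⌈D + 1⌉₊] with n hn y hy
    refine orbitTent_eq_zero hr (not_lt.1 fun hlt => ?_)
    obtain ⟨z, hz, hyz⟩ := (infDist_lt_iff ⟨x m, mem_isoOrbit_self H (x m)⟩).1 hlt
    have h1 : dist z x₀ < D := hD hz
    have h2 : D + 1 ≤ n := Nat.ceil_le.1 hn
    have h3 : (n : ℝ) ≤ dist (x n) x₀ := (le_max_right _ _).trans (hx n)
    have h4 := mem_ball'.1 hy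
    linarith [dist_triangle4 (x n) y z x₀]
  obtain ⟨w, hw, θ, hθ, hlim⟩ : ∃ w ∈ lpVar μ β, ∃ θ : ℕ → ℕ, StrictMono θ ∧
      Tendsto (fun n => lpNormVar μ β (fun x => v (θ n) x - w x)) atTop (𝓝 0) := by
    rcases hemb with h | h
    · exact h.2 v (fun n => ⟨(hvB n).1.1, hvH n⟩) ⟨B, hB, fun n => (hvB n).1.2⟩
    · exact h.2 v (fun n => ⟨(hvB n).2.1, hvH n⟩) ⟨B, hB, fun n => (hvB n).2.2⟩
  exact not_tendsto_lpNormVar hβ.1 (x := x ∘ θ) (r := r / 2)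
    (hinf (r / 2) ⟨by linarith, by linarith⟩).ne'
    (((iInf_le _ x₀).trans_lt (hball x₀ (r / 2) (by linarith)).2).ne) (fun n => iInf_le _ _)
    (fun n => hvm (θ n)) (fun n y hy => half_le_orbitTent hr hy)
    (fun m => hθ.tendsto_atTop.eventually (hsep (θ m))) hw.1 hlim
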